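/- Let $(R,\mathfrak m)$ be a commutative Noetherian Cohen–Macaulay local ring with minimal multiplicity, that is, there is a system of parameters $\underline x = x_1,\dots,x_d$ of $R$ (where $d=\dim R$) such that $(\underline x)\,\mathfrak m = \mathfrak m^2$. Suppose that $R$ is not a Gorenstein ring. Then every finitely generated $R$-module $M$ of G-dimension zero is free. Here a finitely generated $R$-module $M$ has G-dimension zero if the natural map $M \to \mathrm{Hom}_R(\mathrm{Hom}_R(M,R),R)$ is an isomorphism, and $\mathrm{Ext}^i_R(M,R)=0$ and $\mathrm{Ext}^i_R(\mathrm{Hom}_R(M,R),R)=0$ for all $i>0$. -/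

import Mathlib

open CategoryTheory

universe u

/-- `R` is Gorenstein: it has finite injective dimension as a module over itself.
The class is meant for Noetherian local rings `R`. -/
def IsGorensteinLocal (R : Type u) [CommRing R] : Prop :=
  ∃ n : ℕ, HasInjectiveDimensionLE (ModuleCat.of R R) n

/-- A (Noetherian) local ring `R` is Cohen–Macaulay: `depth R = dim R`, that is, the maximal
ideal contains an `R`-regular sequence whose length is the Krull dimension of `R`. -/
def IsCohenMacaulayLocal (R : Type u) [CommRing R] [IsLocalRing R] : Prop :=
  ∃ rs : List R, (∀ r ∈ rs, r ∈ IsLocalRing.maximalIdeal R) ∧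
    RingTheory.Sequence.IsRegular R rs ∧ (rs.length : WithBot ℕ∞) = ringKrullDim R

/-- `xs = x₁, …, x_d` is a system of parameters of the local ring `R`: `d = dim R`, and the ideal
`(x₁, …, x_d)` is primary to the maximal ideal (its radical is the maximal ideal). -/
def IsSystemOfParameters (R : Type u) [CommRing R] [IsLocalRing R] (xs : List R) : Prop :=
  (xs.length : WithBot ℕ∞) = ringKrullDim R ∧
    (Ideal.ofList xs).radical = IsLocalRing.maximalIdeal R

/-- A Cohen–Macaulay local ring `(R, 𝔪)` has minimal multiplicity if it has a system of
parameters `x₁, …, x_d` with `(x₁, …, x_d) 𝔪 = 𝔪 ^ 2`. -/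
def HasMinimalMultiplicity (R : Type u) [CommRing R] [IsLocalRing R] : Prop :=
  ∃ xs : List R, IsSystemOfParameters R xs ∧
    Ideal.ofList xs * IsLocalRing.maximalIdeal R = IsLocalRing.maximalIdeal R ^ 2

/-- The `R`-module `M` (finitely generated in all applications) has G-dimension zero:
the evaluation map `M → Hom(Hom(M, R), R)` is bijective, and
`Ext^i(M, R) = 0 = Ext^i(Hom(M, R), R)` for all `i > 0`. -/
structure HasGDimensionZero (R : Type u) [CommRing R] (M : Type u) [AddCommGroup M]
    [Module R M] : Prop where
  bijective_eval : Function.Bijective (Module.Dual.eval R M)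
  ext_eq_zero : ∀ i : ℕ, 0 < i →
    Subsingleton (Abelian.Ext (ModuleCat.of R M) (ModuleCat.of R R) i)
  ext_dual_eq_zero : ∀ i : ℕ, 0 < i →
    Subsingleton (Abelian.Ext (ModuleCat.of R (Module.Dual R M)) (ModuleCat.of R R) i)

/-! If a non-free finite `M` satisfies `Ext^i(M, R) = 0` for `i > 0`, then so do its syzygies: a
free syzygy would split off by `free_of_exact`. By Cohen–Macaulayness the parameters `xs` form a
regular sequence, hence become regular on a high enough syzygy `N`. Let `Z ⊆ 𝔪F` be the next minimal
syzygy. Then `Z/(xs)Z` embeds in `F/(xs)F`, and `𝔪Z ⊆ 𝔪²F ⊆ (xs)F`, so `Z/(xs)Z` is a vector space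
over `k = R/𝔪`, nonzero by Nakayama (`maximalIdeal_le_annihilator_quotient`). Killing `xs` moves the
vanishing of Ext to degrees `> d`, so its summand `k` has `Ext^i(k, R) = 0` for `i > d`. By
`isGorensteinLocal_of_subsingleton_ext`, `R` would be Gorenstein. -/

open CategoryTheory.Abelian RingTheory.Sequence IsLocalRing

/-! ### Vanishing of Ext along short exact sequences. -/

section ExtSequences

variable {R : Type u} [CommRing R]
  {A : Type u} [AddCommGroup A] [Module R A]
  {B : Type u} [AddCommGroup B] [Module R B]
  {C : Type u} [AddCommGroup C] [Module R C]
  (Y : Type u) [AddCommGroup Y] [Module R Y]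

/-- The short exact sequence in `ModuleCat` given by an injection and a surjection of modules. -/
lemma ModuleCat.shortExact_of_function_exact {f : A →ₗ[R] B} {g : B →ₗ[R] C}
    (hf : Function.Injective f) (hg : Function.Surjective g) (hfg : Function.Exact f g) :
    (ModuleCat.shortComplexOfCompEqZero f g hfg.linearMap_comp_eq_zero).ShortExact where
  exact := ModuleCat.shortComplex_exact _ hfg
  mono_f := by simpa [ModuleCat.mono_iff_injective] using hf
  epi_g := by simpa [ModuleCat.epi_iff_surjective] using hg

lemma subsingleton_ext_middle {f : A →ₗ[R] B} {g : B →ₗ[R] C}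
    (hf : Function.Injective f) (hg : Function.Surjective g) (hfg : Function.Exact f g) (i : ℕ)
    (hA : Subsingleton (Ext (ModuleCat.of R A) (ModuleCat.of R Y) i))
    (hC : Subsingleton (Ext (ModuleCat.of R C) (ModuleCat.of R Y) i)) :
    Subsingleton (Ext (ModuleCat.of R B) (ModuleCat.of R Y) i) := by
  refine subsingleton_of_forall_eq 0 fun x ↦ ?_
  obtain ⟨y, rfl⟩ := Ext.contravariant_sequence_exact₂
    (ModuleCat.shortExact_of_function_exact hf hg hfg) _ x (hA.elim _ _)
  rw [hC.elim y 0, Ext.comp_zero]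

lemma subsingleton_ext_right {f : A →ₗ[R] B} {g : B →ₗ[R] C}
    (hf : Function.Injective f) (hg : Function.Surjective g) (hfg : Function.Exact f g) (i : ℕ)
    (hA : Subsingleton (Ext (ModuleCat.of R A) (ModuleCat.of R Y) i))
    (hB : Subsingleton (Ext (ModuleCat.of R B) (ModuleCat.of R Y) (i + 1))) :
    Subsingleton (Ext (ModuleCat.of R C) (ModuleCat.of R Y) (i + 1)) := by
  refine subsingleton_of_forall_eq 0 fun x ↦ ?_
  obtain ⟨y, rfl⟩ := Ext.contravariant_sequence_exact₃
    (ModuleCat.shortExact_of_function_exact hf hg hfg) _ x (hB.elim _ _) (add_comm 1 i)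
  rw [hA.elim y 0, Ext.comp_zero]

lemma subsingleton_ext_left {f : A →ₗ[R] B} {g : B →ₗ[R] C}
    (hf : Function.Injective f) (hg : Function.Surjective g) (hfg : Function.Exact f g) (i : ℕ)
    (hB : Subsingleton (Ext (ModuleCat.of R B) (ModuleCat.of R Y) i))
    (hC : Subsingleton (Ext (ModuleCat.of R C) (ModuleCat.of R Y) (i + 1))) :
    Subsingleton (Ext (ModuleCat.of R A) (ModuleCat.of R Y) i) := by
  refine subsingleton_of_forall_eq 0 fun x ↦ ?_
  obtain ⟨y, rfl⟩ := Ext.contravariant_sequence_exact₁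
    (ModuleCat.shortExact_of_function_exact hf hg hfg) _ x (add_comm 1 i) (hC.elim _ _)
  rw [hB.elim y 0, Ext.comp_zero]

lemma subsingleton_ext_of_retract (s : A →ₗ[R] B) (r : B →ₗ[R] A) (h : r ∘ₗ s = LinearMap.id)
    (i : ℕ) (hB : Subsingleton (Ext (ModuleCat.of R B) (ModuleCat.of R Y) i)) :
    Subsingleton (Ext (ModuleCat.of R A) (ModuleCat.of R Y) i) := by
  refine subsingleton_of_forall_eq 0 fun x ↦ ?_
  have hid : ModuleCat.ofHom s ≫ ModuleCat.ofHom r = 𝟙 (ModuleCat.of R A) := by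
    rw [← ModuleCat.ofHom_comp, h, ModuleCat.ofHom_id]
  calc x = (Ext.mk₀ (𝟙 (ModuleCat.of R A))).comp x (zero_add i) := by simp
    _ = (Ext.mk₀ (ModuleCat.ofHom s)).comp
          ((Ext.mk₀ (ModuleCat.ofHom r)).comp x (zero_add i)) (zero_add i) := by
        rw [Ext.mk₀_comp_mk₀_assoc, hid]
    _ = 0 := by rw [hB.elim ((Ext.mk₀ (ModuleCat.ofHom r)).comp x (zero_add i)) 0, Ext.comp_zero]

lemma subsingleton_ext_of_linearEquiv (e : A ≃ₗ[R] B) (i : ℕ)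
    (hB : Subsingleton (Ext (ModuleCat.of R B) (ModuleCat.of R Y) i)) :
    Subsingleton (Ext (ModuleCat.of R A) (ModuleCat.of R Y) i) :=
  subsingleton_ext_of_retract Y e.toLinearMap e.symm.toLinearMap (by ext; simp) i hB

lemma subsingleton_ext_of_subsingleton [Subsingleton A] (i : ℕ) :
    Subsingleton (Ext (ModuleCat.of R A) (ModuleCat.of R Y) i) := by
  refine subsingleton_of_forall_eq 0 fun x ↦ ?_
  have hid : 𝟙 (ModuleCat.of R A) = 0 := by
    ext a; exact Subsingleton.elim (α := A) _ _
  calc x = (Ext.mk₀ (𝟙 (ModuleCat.of R A))).comp x (zero_add i) := by simp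
    _ = 0 := by rw [hid, Ext.mk₀_zero, Ext.zero_comp]

lemma subsingleton_ext_of_free (A : Type u) [AddCommGroup A] [Module R A] [Module.Free R A]
    (i : ℕ) : Subsingleton (Ext (ModuleCat.of R A) (ModuleCat.of R Y) (i + 1)) :=
  Ext.subsingleton_of_projective _ _ i

open Pointwise in
lemma exact_lsmul_mkQ (y : R) : Function.Exact (LinearMap.lsmul R A y)
    (Submodule.mkQ (y • (⊤ : Submodule R A))) :=
  LinearMap.exact_lsmul_mkQ_smul_top A y

-- The long exact sequence makes multiplication by `y` surjective on the finitely generated module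
-- `Ext^i(A, Y)`, so Nakayama applies.
open Pointwise in
lemma subsingleton_ext_of_quotSMulTop [IsNoetherianRing R] [IsLocalRing R] [Module.Finite R A]
    [Module.Finite R Y] {y : R} (hy : y ∈ maximalIdeal R) (hreg : IsSMulRegular A y) (i : ℕ)
    (h : Subsingleton (Ext (ModuleCat.of R (QuotSMulTop y A)) (ModuleCat.of R Y) (i + 1))) :
    Subsingleton (Ext (ModuleCat.of R A) (ModuleCat.of R Y) i) := by
  have htop : (⊤ : Submodule R (Ext (ModuleCat.of R A) (ModuleCat.of R Y) i)) ≤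
      Ideal.span {y} • ⊤ := by
    intro x _
    obtain ⟨z, rfl⟩ := Ext.contravariant_sequence_exact₁
      (IsSMulRegular.smulShortComplex_shortExact (M := ModuleCat.of R A) hreg)
      _ x (add_comm 1 i) (h.elim _ _)
    have hz (z : Ext (ModuleCat.of R A) (ModuleCat.of R Y) i) :
        (Ext.mk₀ (y • 𝟙 (ModuleCat.of R A))).comp z (zero_add i) = y • z := by
      rw [Ext.mk₀_smul, Ext.smul_comp]
      simp
    refine Set.mem_of_eq_of_mem (hz z) ?_
    exact Submodule.smul_mem_smul (Ideal.mem_span_singleton_self y) trivial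
  have := Submodule.eq_bot_of_le_smul_of_le_jacobson_bot (Ideal.span {y}) _
    Module.Finite.fg_top htop (by
      rw [Ideal.span_singleton_le_iff_mem]
      exact IsLocalRing.maximalIdeal_le_jacobson _ hy)
  exact (Submodule.subsingleton_iff R).mp (subsingleton_of_bot_eq_top this.symm)

end ExtSequences

/-- Each regular element raises the vanishing bound by one. -/
lemma subsingleton_ext_quotient_ofList {R : Type u} [CommRing R]
    (Y : Type u) [AddCommGroup Y] [Module R Y] (rs : List R) (n : ℕ)
    (N : Type u) [AddCommGroup N] [Module R N] (hreg : IsWeaklyRegular N rs)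
    (hN : ∀ i, n < i → Subsingleton (Ext (ModuleCat.of R N) (ModuleCat.of R Y) i)) (i : ℕ)
    (hi : n + rs.length < i) :
    Subsingleton (Ext (ModuleCat.of R (N ⧸ (Ideal.ofList rs • ⊤ : Submodule R N)))
      (ModuleCat.of R Y) i) := by
  induction rs generalizing n N with
  | nil =>
    refine subsingleton_ext_of_linearEquiv Y (Submodule.quotEquivOfEqBot _ (by simp)) i
      (hN i (by simpa using hi))
  | cons r rs ih =>
    rw [isWeaklyRegular_cons_iff] at hreg
    refine subsingleton_ext_of_linearEquiv Y
      (Submodule.quotOfListConsSMulTopEquivQuotSMulTopInner N r rs) i ?_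
    refine ih (n + 1) (QuotSMulTop r N) hreg.2 (fun j hj ↦ ?_)
      (by simp only [List.length_cons] at hi; omega)
    obtain ⟨j, rfl⟩ : ∃ k, j = k + 1 := ⟨j - 1, by omega⟩
    exact subsingleton_ext_right Y (f := LinearMap.lsmul R N r) hreg.1
      (Submodule.mkQ_surjective _) (exact_lsmul_mkQ r) j (hN j (by omega)) (hN (j + 1) (by omega))

/-! ### Injective dimension from Ext of cyclic modules. -/

section InjectiveDimension

variable {R : Type u} [CommRing R]

/-- Baer's criterion: the obstruction to extending a map `I → X` to `R` lies in `Ext^1(R/I, X)`. -/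
lemma injective_of_subsingleton_ext_one (X : ModuleCat.{u} R)
    (h : ∀ I : Ideal R, Subsingleton (Ext (ModuleCat.of R (R ⧸ I)) X 1)) : Injective X := by
  rw [← Module.injective_iff_injective_object, ← Module.Baer.iff_injective]
  intro I g
  have hS := ModuleCat.shortExact_of_function_exact (f := I.subtype) (g := I.mkQ)
    I.injective_subtype I.mkQ_surjective (LinearMap.exact_subtype_mkQ I)
  obtain ⟨x, hx⟩ := Ext.contravariant_sequence_exact₁ hS (Y := X) (n₀ := 0)
    (Ext.mk₀ (ModuleCat.ofHom g)) (add_comm 1 0) ((h I).elim _ _)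
  obtain ⟨φ, rfl⟩ := (Ext.mk₀_bijective _ _).2 x
  rw [Ext.mk₀_comp_mk₀, (Ext.mk₀_bijective _ _).1.eq_iff] at hx
  refine ⟨φ.hom, fun x hx' ↦ ?_⟩
  exact congr($hx ⟨x, hx'⟩)

lemma hasInjectiveDimensionLE_of_subsingleton_ext (n : ℕ) (X : ModuleCat.{u} R)
    (h : ∀ I : Ideal R, Subsingleton (Ext (ModuleCat.of R (R ⧸ I)) X (n + 1))) :
    HasInjectiveDimensionLE X n := by
  induction n generalizing X with
  | zero =>
    have := injective_of_subsingleton_ext_one X h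
    exact inferInstanceAs (HasInjectiveDimensionLT X 1)
  | succ n ih =>
    -- Dimension shifting: the cokernel of an embedding into an injective has its Ext one degree
    -- lower.
    obtain ⟨J, hJ, f, hf⟩ := (inferInstance : EnoughInjectives (ModuleCat.{u} R)).1 X
    let S := ShortComplex.mk f (Limits.cokernel.π f) (Limits.cokernel.condition f)
    have hS : S.ShortExact := { exact := ShortComplex.exact_cokernel f }
    refine (hS.hasInjectiveDimensionLT_X₃_iff n hJ).mp (ih S.X₃ fun I ↦ ?_)
    refine subsingleton_of_forall_eq 0 fun x ↦ ?_
    obtain ⟨y, rfl⟩ := Ext.covariant_sequence_exact₃ _ hS x rfl ((h I).elim _ _)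
    rw [Ext.eq_zero_of_injective (I := S.X₂) y, Ext.zero_comp]

end InjectiveDimension

lemma mem_support_quotient_ideal {R : Type u} [CommRing R] {I : Ideal R} {p : PrimeSpectrum R} :
    p ∈ Module.support R (R ⧸ I) ↔ I ≤ p.asIdeal := by
  rw [Module.support_eq_zeroLocus, Ideal.annihilator_quotient]
  rfl

/-! ### Depth, and regularity of systems of parameters. -/

section Depth

variable {R : Type u} [CommRing R] [IsNoetherianRing R] [IsLocalRing R]

/-- If `Ext^i(L, Y)` vanishes for `i < d` and all `L` of finite length, then it vanishes for
`i + r < d` and all finite `L` which become of finite length modulo `r` elements. -/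
lemma subsingleton_ext_of_support (Y : Type u) [AddCommGroup Y] [Module R Y] [Module.Finite R Y]
    (d : ℕ)
    (hY : ∀ (L : Type u) [AddCommGroup L] [Module R L] [Module.Finite R L],
      (∀ p ∈ Module.support R L, p.asIdeal = maximalIdeal R) → ∀ i < d,
        Subsingleton (Ext (ModuleCat.of R L) (ModuleCat.of R Y) i))
    (ys : List R) (hys : ∀ y ∈ ys, y ∈ maximalIdeal R)
    (L : Type u) [AddCommGroup L] [Module R L] [hL : Module.Finite R L]
    (hsupp : ∀ p ∈ Module.support R L, (∀ y ∈ ys, y ∈ p.asIdeal) → p.asIdeal = maximalIdeal R)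
    (i : ℕ) (hi : i + ys.length < d) :
    Subsingleton (Ext (ModuleCat.of R L) (ModuleCat.of R Y) i) := by
  induction ys generalizing L i with
  | nil => exact hY L (by simpa using hsupp) i (by simpa using hi)
  | cons y ys ih =>
    simp only [List.mem_cons, forall_eq_or_imp, List.length_cons] at hys hsupp hi
    revert hsupp
    -- A prime filtration reduces to `L = R/p`. If `y ∈ p`, then `y` can be dropped from the list;
    -- otherwise `y` is regular on `R/p`, and passing to `R/(p + (y))` costs one degree, paid for by
    -- the shorter list.
    refine IsNoetherianRing.induction_on_isQuotientEquivQuotientPrime R hL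
      (motive := fun L _ _ _ ↦ (∀ p ∈ Module.support R L,
        (y ∈ p.asIdeal ∧ ∀ y ∈ ys, y ∈ p.asIdeal) → p.asIdeal = maximalIdeal R) →
          Subsingleton (Ext (ModuleCat.of R L) (ModuleCat.of R Y) i))
      ?_ ?_ ?_
    · intro N _ _ _ _ _
      exact subsingleton_ext_of_subsingleton Y i
    · intro N _ _ _ p e hN
      by_cases hyp : y ∈ p.asIdeal
      · refine ih hys.2 N (fun q hq hq' ↦ hN q hq ⟨?_, hq'⟩) i (by omega)
        rw [e.support_eq, mem_support_quotient_ideal] at hq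
        exact hq hyp
      · refine subsingleton_ext_of_quotSMulTop Y (y := y) hys.1 ?_ i ?_
        · rw [e.isSMulRegular_congr]
          exact (isSMulRegular_quotient_iff_mem_of_smul_mem _ _).mpr fun r hr ↦
            (p.2.mem_or_mem hr).resolve_left hyp
        · refine ih hys.2 _ (fun q hq hq' ↦ ?_) (i + 1) (by omega)
          rw [Module.support_quotSMulTop] at hq
          exact hN q hq.1 ⟨by simpa using hq.2, hq'⟩
    · intro N₁ _ _ _ N₂ _ _ _ N₃ _ _ _ f g hf hg hfg h₁ h₃ h₂
      exact subsingleton_ext_middle Y hf hg hfg i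
        (h₁ fun p hp ↦ h₂ p (Module.support_subset_of_injective f hf hp))
        (h₃ fun p hp ↦ h₂ p (Module.support_subset_of_surjective g hg hp))

omit [IsLocalRing R] in
lemma isSMulRegular_of_subsingleton_hom_quotient (N : Type u) [AddCommGroup N] [Module R N] (x : R)
    (h : ∀ p ∈ associatedPrimes R N, x ∈ p → Subsingleton ((R ⧸ p) →ₗ[R] N)) :
    IsSMulRegular N x := by
  by_contra hx
  have hx' : x ∈ ({r : R | IsSMulRegular N r} : Set R)ᶜ := hx
  rw [← biUnion_associatedPrimes_eq_compl_regular] at hx'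
  obtain ⟨p, hp, hxp⟩ := Set.mem_iUnion₂.mp hx'
  obtain ⟨hprime, f, hf⟩ := (isAssociatedPrime_iff_exists_injective_linearMap p N).mp hp
  have := h p hp hxp
  have : Nontrivial (R ⧸ p) := Ideal.Quotient.nontrivial_iff.mpr hprime.ne_top
  exact one_ne_zero (hf (by rw [Subsingleton.elim f 0]; rfl) : (1 : R ⧸ p) = 0)

/-- A zero divisor `x` on `N` lies in an associated prime `p`, giving a nonzero map `R/p → N`. Since
`x ∈ p`, the tail `xs` alone cuts the support of `R/p` down to `𝔪`, so the Ext hypothesis forces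
`Hom(R/p, N) = 0`. -/
lemma isWeaklyRegular_of_subsingleton_ext (xs : List R) (hxs : ∀ x ∈ xs, x ∈ maximalIdeal R)
    (N : Type u) [AddCommGroup N] [Module R N] [Module.Finite R N]
    (hN : ∀ (L : Type u) [AddCommGroup L] [Module R L] [Module.Finite R L],
      (∀ p ∈ Module.support R L, p.asIdeal = maximalIdeal R) → ∀ i < xs.length,
        Subsingleton (Ext (ModuleCat.of R L) (ModuleCat.of R N) i))
    (hsupp : ∀ p ∈ Module.support R N, (∀ x ∈ xs, x ∈ p.asIdeal) → p.asIdeal = maximalIdeal R) :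
    IsWeaklyRegular N xs := by
  induction xs generalizing N with
  | nil => exact .nil R N
  | cons x xs ih =>
    simp only [List.mem_cons, forall_eq_or_imp, List.length_cons] at hxs hN hsupp
    have hreg : IsSMulRegular N x := by
      refine isSMulRegular_of_subsingleton_hom_quotient N x fun p hp hxp ↦ ?_
      have h0 : Subsingleton (Ext (ModuleCat.of R (R ⧸ p)) (ModuleCat.of R N) 0) := by
        refine subsingleton_ext_of_support N (xs.length + 1) hN xs hxs.2 (R ⧸ p)
          (fun q hq hq' ↦ ?_) 0 (by omega)
        rw [mem_support_quotient_ideal] at hq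
        refine hsupp q ?_ ⟨hq hxp, hq'⟩
        rw [Module.support_eq_zeroLocus]
        exact (show Module.annihilator R N ≤ p by
          simpa only [Submodule.annihilator_top] using
            IsAssociatedPrime.annihilator_le hp).trans hq
      exact (Ext.addEquiv₀.trans (ModuleCat.homAddEquiv (M := ModuleCat.of R (R ⧸ p))
        (N := ModuleCat.of R N))).symm.subsingleton
    refine .cons hreg (ih hxs.2 (QuotSMulTop x N) (fun L _ _ _ hL i hi ↦ ?_) fun p hp hp' ↦ ?_)
    · refine subsingleton_of_forall_eq 0 fun z ↦ ?_
      obtain ⟨w, rfl⟩ := Ext.covariant_sequence_exact₃ _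
        (IsSMulRegular.smulShortComplex_shortExact (M := ModuleCat.of R N) hreg) z rfl
        ((hN L hL (i + 1) (by omega)).elim _ _)
      obtain rfl : w = 0 := (hN L hL i (by omega)).elim _ _
      exact Ext.zero_comp ..
    · rw [Module.support_quotSMulTop] at hp
      exact hsupp p hp.1 ⟨by simpa using hp.2, hp'⟩

end Depth

/-! ### The residue field detects finite injective dimension. -/

section Gorenstein

variable {R : Type u} [CommRing R] [IsNoetherianRing R] [IsLocalRing R]

lemma subsingleton_ext_of_residueField (Y : Type u) [AddCommGroup Y] [Module R Y]
    [Module.Finite R Y] (d : ℕ)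
    (hk : ∀ i, d < i → Subsingleton
      (Ext (ModuleCat.of R (R ⧸ maximalIdeal R)) (ModuleCat.of R Y) i))
    (L : Type u) [AddCommGroup L] [Module R L] [hL : Module.Finite R L] (i : ℕ) (hi : d < i) :
    Subsingleton (Ext (ModuleCat.of R L) (ModuleCat.of R Y) i) := by
  -- Noetherian induction on a lower bound `P` for the support. All degrees are treated at once,
  -- because cutting `R/p` by `y ∉ p` enlarges the bound to `p + (y)` but raises the degree.
  have key (P : Ideal R) : ∀ (L : Type u) [AddCommGroup L] [Module R L] [Module.Finite R L],
      (∀ p ∈ Module.support R L, P ≤ p.asIdeal) → ∀ i, d < i →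
        Subsingleton (Ext (ModuleCat.of R L) (ModuleCat.of R Y) i) := by
    induction P using WellFoundedGT.induction with
    | ind P ih =>
    intro L _ _ hL hsupp i hi
    revert hsupp
    refine IsNoetherianRing.induction_on_isQuotientEquivQuotientPrime R hL
      (motive := fun L _ _ _ ↦ (∀ p ∈ Module.support R L, P ≤ p.asIdeal) →
          Subsingleton (Ext (ModuleCat.of R L) (ModuleCat.of R Y) i))
      ?_ ?_ ?_
    · intro N _ _ _ _ _
      exact subsingleton_ext_of_subsingleton Y i
    · intro N _ _ _ p e hN
      by_cases hp : p.asIdeal = maximalIdeal R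
      · rw [hp] at e
        exact subsingleton_ext_of_linearEquiv Y e i (hk i hi)
      · obtain ⟨y, hy, hyp⟩ := SetLike.exists_of_lt
          (lt_of_le_of_ne (le_maximalIdeal p.2.ne_top) hp)
        have hPp : P ≤ p.asIdeal := hN p (by
          rw [e.support_eq, mem_support_quotient_ideal])
        refine subsingleton_ext_of_quotSMulTop Y (y := y) hy ?_ i ?_
        · rw [e.isSMulRegular_congr]
          exact (isSMulRegular_quotient_iff_mem_of_smul_mem _ _).mpr fun r hr ↦
            (p.2.mem_or_mem hr).resolve_left hyp
        · refine ih (p.asIdeal ⊔ Ideal.span {y}) ?_ _ (fun q hq ↦ ?_) (i + 1) (by omega)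
          · refine lt_of_le_of_lt hPp (left_lt_sup.mpr ?_)
            rwa [Ideal.span_singleton_le_iff_mem]
          · rw [Module.support_quotSMulTop, e.support_eq] at hq
            exact sup_le (mem_support_quotient_ideal.mp hq.1) (by
              rw [Ideal.span_singleton_le_iff_mem]; simpa using hq.2)
    · intro N₁ _ _ _ N₂ _ _ _ N₃ _ _ _ f g hf hg hfg h₁ h₃ h₂
      exact subsingleton_ext_middle Y hf hg hfg i
        (h₁ fun p hp ↦ h₂ p (Module.support_subset_of_injective f hf hp))
        (h₃ fun p hp ↦ h₂ p (Module.support_subset_of_surjective g hg hp))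
  exact key ⊥ L (fun _ _ ↦ bot_le) i hi

lemma isGorensteinLocal_of_subsingleton_ext (d : ℕ)
    (hk : ∀ i, d < i → Subsingleton
      (Ext (ModuleCat.of R (R ⧸ maximalIdeal R)) (ModuleCat.of R R) i)) :
    IsGorensteinLocal R :=
  ⟨d, hasInjectiveDimensionLE_of_subsingleton_ext d _ fun I ↦
    subsingleton_ext_of_residueField R d hk (R ⧸ I) (d + 1) (by omega)⟩

end Gorenstein

/-- The given regular sequence serves only to make `Ext^i(L, R)` vanish for `i < d` when `L` is
supported at `𝔪`; this is independent of the sequence and so transfers to `xs`. -/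
lemma IsCohenMacaulayLocal.isWeaklyRegular {R : Type u} [CommRing R] [IsNoetherianRing R]
    [IsLocalRing R] (hCM : IsCohenMacaulayLocal R) {xs : List R}
    (hxs : IsSystemOfParameters R xs) : IsWeaklyRegular R xs := by
  obtain ⟨rs, hrs, hreg, hlen⟩ := hCM
  have hlen' : xs.length = rs.length := by
    have := hxs.1.trans hlen.symm
    exact_mod_cast this
  refine isWeaklyRegular_of_subsingleton_ext xs (fun x hx ↦ ?_) R (fun L _ _ _ hL i hi ↦ ?_)
    fun p _ hp ↦ ?_
  · rw [← hxs.2]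
    exact Ideal.le_radical (Ideal.subset_span hx)
  · refine ModuleCat.subsingleton_ext_of_exists_isRegular (maximalIdeal R) (ModuleCat.of R L)
      (fun p hp ↦ (hL p hp).ge) (ModuleCat.of R R) ?_ rs hrs hreg i (by omega)
    simpa using (Ideal.IsMaximal.ne_top (inferInstance : (maximalIdeal R).IsMaximal)).lt_top
  · refine le_antisymm (le_maximalIdeal p.2.ne_top) ?_
    rw [← hxs.2, p.2.radical_le_iff]
    exact Ideal.span_le.mpr hp

/-- The start of a minimal free resolution. -/
lemma exists_free_surjective_ker_le {R : Type u} [CommRing R] [IsLocalRing R]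
    (M : Type u) [AddCommGroup M] [Module R M] [Module.Finite R M] :
    ∃ (ι : Type u) (_ : Fintype ι) (f : (ι → R) →ₗ[R] M), Function.Surjective f ∧
      LinearMap.ker f ≤ maximalIdeal R • ⊤ := by
  classical
  -- Generators lifting a basis of `k ⊗ M` are minimal: the coefficients of any relation vanish in
  -- `k`.
  let b := Module.Free.chooseBasis (ResidueField R) (TensorProduct R (ResidueField R) M)
  choose m hm using fun i ↦
    TensorProduct.mk_surjective R M (ResidueField R) Ideal.Quotient.mk_surjective (b i)
  refine ⟨_, inferInstance, Fintype.linearCombination R m, ?_, fun c hc ↦ ?_⟩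
  · rw [← LinearMap.range_eq_top, Fintype.range_linearCombination]
    exact span_eq_top_of_tmul_eq_basis m b hm
  · rw [LinearMap.mem_ker, Fintype.linearCombination_apply] at hc
    have hsum : ∑ i, residue R (c i) • b i = 0 := by
      have := congr(TensorProduct.mk R (ResidueField R) M 1 $hc)
      rw [map_sum, map_zero] at this
      rw [← this]
      refine Finset.sum_congr rfl fun i _ ↦ ?_
      rw [map_smul, hm, ← algebraMap_smul (ResidueField R) (c i)]
      rfl
    have hzero := Fintype.linearIndependent_iff.mp b.linearIndependent _ hsum
    rw [pi_eq_sum_univ' c]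
    exact Submodule.sum_mem _ fun i _ ↦ Submodule.smul_mem_smul
      ((residue_eq_zero_iff _).mp (hzero i)) trivial

/-! ### Regular sequences and freeness of syzygies. -/

section Syzygy

variable {R : Type u} [CommRing R]
  {A : Type u} [AddCommGroup A] [Module R A]
  {B : Type u} [AddCommGroup B] [Module R B]
  {C : Type u} [AddCommGroup C] [Module R C]

/-- Regularity on the cokernel `C` plays the role of `Tor₁(C, R/(rs)) = 0`. -/
lemma injective_mapQ_of_isWeaklyRegular {f : A →ₗ[R] B} {g : B →ₗ[R] C}
    (hf : Function.Injective f) (hg : Function.Surjective g) (hfg : Function.Exact f g)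
    {rs : List R} (h : IsWeaklyRegular C rs) :
    Function.Injective (Submodule.mapQ (Ideal.ofList rs • ⊤) (Ideal.ofList rs • ⊤) f
      (Submodule.smul_top_le_comap_smul_top (Ideal.ofList rs) f)) := by
  have h0 : Function.Exact (0 : PUnit.{u + 1} →ₗ[R] A) f :=
    (f.exact_zero_iff_injective _).mpr hf
  have := map_first_exact_on_four_term_right_exact_of_isSMulRegular_last h0 hfg hg h
  rw [injective_iff_map_eq_zero]
  intro a ha
  obtain ⟨z, rfl⟩ := (this a).mp ha
  obtain ⟨z, rfl⟩ := Submodule.mkQ_surjective _ z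
  simp

lemma RingTheory.Sequence.IsWeaklyRegular.of_exact {f : A →ₗ[R] B} {g : B →ₗ[R] C}
    (hf : Function.Injective f) (hg : Function.Surjective g) (hfg : Function.Exact f g)
    {rs : List R} (hC : IsWeaklyRegular C rs) (hB : IsWeaklyRegular B rs) :
    IsWeaklyRegular A rs := by
  induction rs using List.reverseRecOn with
  | nil => exact .nil R A
  | append_singleton rs r ih =>
    rw [isWeaklyRegular_append_iff, isWeaklyRegular_singleton_iff] at hC hB ⊢
    exact ⟨ih hC.1 hB.1, hB.2.of_injective _ (injective_mapQ_of_isWeaklyRegular hf hg hfg hC.1)⟩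

/-- The syzygy gains one regular element over `C`: modulo `rs` it still embeds in `B`, where `r` is
regular. -/
lemma RingTheory.Sequence.IsWeaklyRegular.append_singleton_of_exact {f : A →ₗ[R] B} {g : B →ₗ[R] C}
    (hf : Function.Injective f) (hg : Function.Surjective g) (hfg : Function.Exact f g)
    {rs : List R} {r : R} (hC : IsWeaklyRegular C rs) (hB : IsWeaklyRegular B (rs ++ [r])) :
    IsWeaklyRegular A (rs ++ [r]) := by
  rw [isWeaklyRegular_append_iff, isWeaklyRegular_singleton_iff] at hB ⊢
  exact ⟨.of_exact hf hg hfg hC hB.1,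
    hB.2.of_injective _ (injective_mapQ_of_isWeaklyRegular hf hg hfg hC)⟩

lemma isWeaklyRegular_of_free {rs : List R} (h : IsWeaklyRegular R rs) [Module.Free R A] :
    IsWeaklyRegular A rs :=
  ((TensorProduct.rid R A).isWeaklyRegular_congr rs).mp h.isWeaklyRegular_lTensor

/-- A sequence `0 → A → B → C → 0` with `A` free and `Ext^1(C, R) = 0` splits. -/
lemma free_of_exact [IsLocalRing R] [IsNoetherianRing R] [Module.Finite R B] [Module.Free R B]
    [Module.Free R A] {f : A →ₗ[R] B} {g : B →ₗ[R] C}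
    (hf : Function.Injective f) (hg : Function.Surjective g) (hfg : Function.Exact f g)
    (hC : Subsingleton (Ext (ModuleCat.of R C) (ModuleCat.of R R) 1)) :
    Module.Free R C := by
  have : Module.Finite R A := Module.Finite.of_injective f hf
  have : Module.Finite R C := Module.Finite.of_surjective g hg
  let b := Module.Free.chooseBasis R A
  -- Functionals on `A` extend to `B` because the obstruction lies in `Ext^1(C, R)`; extending the
  -- coordinates of a basis gives a retraction of `f`.
  have hext (φ : A →ₗ[R] R) : ∃ ψ : B →ₗ[R] R, ψ ∘ₗ f = φ := by
    obtain ⟨x, hx⟩ := Ext.contravariant_sequence_exact₁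
      (ModuleCat.shortExact_of_function_exact hf hg hfg) _ (n₀ := 0)
      (Ext.mk₀ (ModuleCat.ofHom φ)) (add_comm 1 0) (hC.elim _ _)
    obtain ⟨ψ, rfl⟩ := (Ext.mk₀_bijective _ _).2 x
    rw [Ext.mk₀_comp_mk₀, (Ext.mk₀_bijective _ _).1.eq_iff] at hx
    exact ⟨ψ.hom, congr(ModuleCat.Hom.hom $hx)⟩
  choose ψ hψ using fun i ↦ hext (b.coord i)
  let r : B →ₗ[R] A := b.equivFun.symm.toLinearMap ∘ₗ LinearMap.pi ψ
  have hr : r ∘ₗ f = LinearMap.id := by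
    ext a
    refine b.equivFun.injective (funext fun i ↦ ?_)
    rw [LinearMap.comp_apply, LinearMap.comp_apply, LinearEquiv.coe_coe,
      LinearEquiv.apply_symm_apply]
    exact congr($(hψ i) a)
  have hsplit : Function.Surjective g ∧ ∃ l, l ∘ₗ f = LinearMap.id := ⟨hg, r, hr⟩
  obtain ⟨-, s, hs⟩ := (hfg.split_tfae'.out 1 0).mp hsplit
  have : Module.Projective R C := Module.Projective.of_split s g hs
  exact Module.free_of_flat_of_isLocalRing

end Syzygy

/-- A nonzero module killed by a maximal ideal `I` has `R ⧸ I` as a direct summand. -/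
lemma exists_retract_of_le_annihilator {R : Type u} [CommRing R] (I : Ideal R) [hI : I.IsMaximal]
    (V : Type u) [AddCommGroup V] [Module R V] [Nontrivial V] (hV : I ≤ Module.annihilator R V) :
    ∃ (s : (R ⧸ I) →ₗ[R] V) (r : V →ₗ[R] (R ⧸ I)), r ∘ₗ s = LinearMap.id := by
  let _ : Field (R ⧸ I) := Ideal.Quotient.field I
  have htor : Module.IsTorsionBySet R V I := fun v a ↦
    Module.mem_annihilator.mp (hV a.2) v
  let _ : Module (R ⧸ I) V := htor.module
  have : IsScalarTower R (R ⧸ I) V := htor.isScalarTower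
  obtain ⟨v, hv⟩ := exists_ne (0 : V)
  obtain ⟨r, hr⟩ := (LinearMap.toSpanSingleton (R ⧸ I) V v).exists_leftInverse_of_injective
    (LinearMap.ker_toSpanSingleton _ hv)
  refine ⟨(LinearMap.toSpanSingleton (R ⧸ I) V v).restrictScalars R, r.restrictScalars R, ?_⟩
  refine LinearMap.ext fun x ↦ ?_
  exact congr($hr x)

section Syzygy

variable {R : Type u} [CommRing R] [IsNoetherianRing R] [IsLocalRing R]

/-- The syzygies of `M` inherit the vanishing of `Ext^i(M, R)`, and they are not free if `M`
is not. -/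
lemma not_free_ker_and_subsingleton_ext (M : Type u) [AddCommGroup M] [Module R M]
    (hfree : ¬ Module.Free R M)
    (hM : ∀ i, 0 < i → Subsingleton (Ext (ModuleCat.of R M) (ModuleCat.of R R) i))
    {F : Type u} [AddCommGroup F] [Module R F] [Module.Finite R F] [Module.Free R F]
    (f : F →ₗ[R] M) (hf : Function.Surjective f) :
    ¬ Module.Free R (LinearMap.ker f) ∧ ∀ i, 0 < i →
      Subsingleton (Ext (ModuleCat.of R (LinearMap.ker f)) (ModuleCat.of R R) i) := by
  refine ⟨fun h ↦ hfree (free_of_exact (Submodule.subtype_injective _) hf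
    f.exact_subtype_ker_map (hM 1 one_pos)), fun i hi ↦ ?_⟩
  obtain ⟨i, rfl⟩ : ∃ k, i = k + 1 := ⟨i - 1, by omega⟩
  exact subsingleton_ext_left R (Submodule.subtype_injective _) hf f.exact_subtype_ker_map _
    (subsingleton_ext_of_free R F i) (hM _ (by omega))

/-- One syzygy is taken for each element of `rs`. -/
lemma exists_isWeaklyRegular_not_free (M : Type u) [AddCommGroup M] [Module R M]
    [Module.Finite R M] (hfree : ¬ Module.Free R M)
    (hM : ∀ i, 0 < i → Subsingleton (Ext (ModuleCat.of R M) (ModuleCat.of R R) i))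
    (rs : List R) (hrs : IsWeaklyRegular R rs) :
    ∃ (N : Type u) (_ : AddCommGroup N) (_ : Module R N), Module.Finite R N ∧
      IsWeaklyRegular N rs ∧ ¬ Module.Free R N ∧
      ∀ i, 0 < i → Subsingleton (Ext (ModuleCat.of R N) (ModuleCat.of R R) i) := by
  induction rs using List.reverseRecOn with
  | nil => exact ⟨M, _, _, inferInstance, .nil R M, hfree, hM⟩
  | append_singleton rs r ih =>
    obtain ⟨N, _, _, _, hreg, hN, hext⟩ := ih ((isWeaklyRegular_append_iff _ _ _).mp hrs).1
    obtain ⟨ι, _, f, hf, -⟩ := exists_free_surjective_ker_le (R := R) N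
    exact ⟨LinearMap.ker f, _, _, inferInstance,
      .append_singleton_of_exact (Submodule.subtype_injective _) hf f.exact_subtype_ker_map hreg
        (isWeaklyRegular_of_free hrs),
      not_free_ker_and_subsingleton_ext N hN hext f hf⟩

omit [IsNoetherianRing R] in
/-- Over a ring whose maximal ideal `𝔪` satisfies `𝔪 ^ 2 ⊆ (rs)` for a regular sequence `rs`,
a syzygy of a module on which `rs` is regular becomes a vector space modulo `rs`. -/
lemma maximalIdeal_le_annihilator_quotient {rs : List R}
    (hrs : maximalIdeal R ^ 2 ≤ Ideal.ofList rs)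
    (N : Type u) [AddCommGroup N] [Module R N] (hN : IsWeaklyRegular N rs)
    {F : Type u} [AddCommGroup F] [Module R F] (f : F →ₗ[R] N) (hf : Function.Surjective f)
    (hker : LinearMap.ker f ≤ maximalIdeal R • ⊤) :
    maximalIdeal R ≤ Module.annihilator R
      (LinearMap.ker f ⧸ (Ideal.ofList rs • ⊤ : Submodule R (LinearMap.ker f))) := by
  intro a ha
  rw [Module.mem_annihilator]
  intro z
  obtain ⟨z, rfl⟩ := Submodule.mkQ_surjective _ z
  refine injective_mapQ_of_isWeaklyRegular (Submodule.subtype_injective _) hf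
    f.exact_subtype_ker_map hN ?_
  rw [map_zero, ← map_smul]
  refine (Submodule.Quotient.mk_eq_zero _).mpr ?_
  -- One factor `𝔪` comes from `a`, the other from minimality of the cover.
  have hmem : a • (z : F) ∈ maximalIdeal R • maximalIdeal R • (⊤ : Submodule R F) :=
    Submodule.smul_mem_smul ha (hker z.2)
  rw [← Submodule.mul_smul, ← pow_two] at hmem
  exact Submodule.smul_mono_left hrs hmem

end Syzygy

/-! ### The main theorem. -/

theorem mainTheorem6 (R : Type u) [CommRing R] [IsNoetherianRing R] [IsLocalRing R]
    (hCM : IsCohenMacaulayLocal R) (hmin : HasMinimalMultiplicity R)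
    (hGor : ¬ IsGorensteinLocal R)
    (M : Type u) [AddCommGroup M] [Module R M] [Module.Finite R M]
    (hM : HasGDimensionZero R M) :
    Module.Free R M := by
  by_contra hfree
  obtain ⟨xs, hxs, hmul⟩ := hmin
  have hreg := hCM.isWeaklyRegular hxs
  have hxs_le : Ideal.ofList xs ≤ maximalIdeal R := hxs.2 ▸ Ideal.le_radical
  obtain ⟨N, _, _, _, hNreg, hNfree, hNext⟩ :=
    exists_isWeaklyRegular_not_free M hfree hM.ext_eq_zero xs hreg
  obtain ⟨ι, _, f, hf, hker⟩ := exists_free_surjective_ker_le (R := R) N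
  obtain ⟨hZfree, hZext⟩ := not_free_ker_and_subsingleton_ext N hNfree hNext f hf
  have hZreg : IsWeaklyRegular (LinearMap.ker f) xs :=
    .of_exact (Submodule.subtype_injective _) hf f.exact_subtype_ker_map hNreg
      (isWeaklyRegular_of_free hreg)
  have : Nontrivial (LinearMap.ker f) := by
    by_contra h
    rw [not_nontrivial_iff_subsingleton] at h
    exact hZfree inferInstance
  have : Nontrivial (LinearMap.ker f ⧸ (Ideal.ofList xs • ⊤ : Submodule R (LinearMap.ker f))) := by
    refine Submodule.Quotient.nontrivial_iff.mpr fun h ↦ top_ne_bot (α := Submodule R _) <|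
      Submodule.eq_bot_of_le_smul_of_le_jacobson_bot (Ideal.ofList xs) _ Module.Finite.fg_top h.ge
        (hxs_le.trans (maximalIdeal_le_jacobson _))
  -- Minimal multiplicity enters here, as `𝔪² = (xs)𝔪 ⊆ (xs)`.
  obtain ⟨s, r, hsr⟩ := exists_retract_of_le_annihilator (maximalIdeal R) _
    (maximalIdeal_le_annihilator_quotient (hmul ▸ Ideal.mul_le_left) N hNreg f hf hker)
  refine hGor (isGorensteinLocal_of_subsingleton_ext xs.length fun i hi ↦ ?_)
  exact subsingleton_ext_of_retract R s r hsr i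
    (subsingleton_ext_quotient_ofList R xs 0 (LinearMap.ker f) hZreg hZext i (by omega))
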